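/- Let $\varepsilon\in\{1,-1\}$ and let $\langle x,y\rangle=\varepsilon x_1y_1+x_2y_2+x_3y_3+x_4y_4$ on $\mathbb R^4$. Let $\mathbb M^2(\varepsilon)\times\mathbb R\subset\mathbb R^4$ be $\mathbb S^2\times\mathbb R=\{x_1^2+x_2^2+x_3^2=1\}$ if $\varepsilon=1$, and $\mathbb H^2\times\mathbb R=\{-x_1^2+x_2^2+x_3^2=-1,\ x_1>0\}$ if $\varepsilon=-1$, with the metric induced by $\langle\,,\rangle$. Let $S$ be an orientable surface and $\psi:S\to\mathbb M^2(\varepsilon)\times\mathbb R$ a smooth immersion with smooth unit normal vector field $N$. Let $I=\langle d\psi,d\psi\rangle$ and $II=\langle -dN,d\psi\rangle$ be its first and second fundamental forms and $h$ its height function, i.e. the fourth coordinate of $\psi$. Assume that the Gaussian curvature of the metric $I$ is a constant $K$ with $K\neq\varepsilon$, and that the quadratic form $$A=I+\frac{1}{\varepsilon K-1}\,dh^2$$ is a Riemannian metric on $S$. Then $(A,II)$ is a Codazzi pair of constant extrinsic curvature $K(A,II)=K-\varepsilon$. That is, in all local parameters $(u,v)$ on $S$, writing $A=E\,du^2+2F\,du\,dv+G\,dv^2$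 and $II=e\,du^2+2f\,du\,dv+g\,dv^2$, and denoting by $\Gamma_{ij}^k$ the Christoffel symbols of $A$, $$e_v-f_u=e\,\Gamma_{12}^1+f(\Gamma_{12}^2-\Gamma_{11}^1)-g\,\Gamma_{11}^2,\qquad f_v-g_u=e\,\Gamma_{22}^1+f(\Gamma_{22}^2-\Gamma_{12}^1)-g\,\Gamma_{12}^2,$$ $$\frac{eg-f^2}{EG-F^2}=K-\varepsilon .$$ -/

import Mathlib

open scoped Manifold ContDiff

noncomputable section

namespace ProductSurface

/-- The Euclidean plane, model space of surfaces. -/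
abbrev E2 : Type := EuclideanSpace ℝ (Fin 2)

/-- The vector space `ℝ⁴`; its coordinates are numbered `0, 1, 2, 3`. -/
abbrev E4 : Type := EuclideanSpace ℝ (Fin 4)

/-! ### The ambient space -/

/-- The metric `ε x₀ y₀ + x₁ y₁ + x₂ y₂ + x₃ y₃` of `ℝ⁴`: Euclidean for `ε = 1`,
Lorentzian for `ε = -1`. -/
def ambient (ε : ℝ) : LinearMap.BilinForm ℝ E4 :=
  LinearMap.mk₂ ℝ (fun x y => ε * x 0 * y 0 + x 1 * y 1 + x 2 * y 2 + x 3 * y 3)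
    (by intro x x' y; simp; ring) (by intro c x y; simp; ring)
    (by intro x y y'; simp; ring) (by intro c x y; simp; ring)

/-- `M²(ε) × ℝ` as a submanifold of `ℝ⁴`: `𝕊² × ℝ` for `ε = 1`, and `ℍ² × ℝ`
(hyperboloid model) for `ε = -1`. -/
def productSpace (ε : ℝ) : Set E4 :=
  {x | ε * x 0 ^ 2 + x 1 ^ 2 + x 2 ^ 2 = ε ∧ (ε = -1 → 0 < x 0)}

/-- The unit normal `η(x) = (x₀, x₁, x₂, 0)` of `M²(ε) × ℝ` in `ℝ⁴`. -/
def eta (x : E4) : E4 := !₂[x 0, x 1, x 2, 0]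

/-! ### Bilinear form fields on a surface and their expressions in local parameters -/

section Surface

variable {S : Type*} [TopologicalSpace S] [ChartedSpace E2 S]

variable (S) in
/-- A field of real bilinear forms on the tangent planes of `S`. -/
abbrev FormField : Type _ := (p : S) → LinearMap.BilinForm ℝ (TangentSpace (𝓡 2) p)

/-- `∂/∂u` (`i = 0`) and `∂/∂v` (`i = 1`) in the plane of parameters. -/
def e (i : Fin 2) : E2 := EuclideanSpace.single i 1

/-- The coordinate vector `∂/∂u` or `∂/∂v` of the chart `φ`, at the point of `S` with
parameters `x`. -/
def coordVec (φ : OpenPartialHomeomorph S E2) (x : E2) (i : Fin 2) :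
    TangentSpace (𝓡 2) (φ.symm x) :=
  mfderiv (𝓡 2) (𝓡 2) φ.symm x (e i)

/-- The coefficients of a form field in the chart `φ`: for `A = E du² + 2F du dv + G dv²`
this is the matrix `!![E, F; F, G]`, as a function of the parameters. -/
def coeff (A : FormField S) (φ : OpenPartialHomeomorph S E2) (x : E2) :
    Matrix (Fin 2) (Fin 2) ℝ :=
  Matrix.of fun i j => A (φ.symm x) (coordVec φ x i) (coordVec φ x j)

/-- Partial derivative with respect to the `i`-th parameter. -/
def pd (i : Fin 2) (f : E2 → ℝ) (x : E2) : ℝ := fderiv ℝ f x (e i)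

/-- The Christoffel symbol `Γᵢⱼᵏ` of `A` in the chart `φ`. -/
def christoffel (A : FormField S) (φ : OpenPartialHomeomorph S E2) (k i j : Fin 2)
    (x : E2) : ℝ :=
  (1 / 2) * ∑ l, (coeff A φ x)⁻¹ k l *
    (pd i (fun y => coeff A φ y j l) x + pd j (fun y => coeff A φ y i l) x
      - pd l (fun y => coeff A φ y i j) x)

/-- The `l`-th component of `R(∂ᵤ, ∂ᵥ)∂ᵥ = ∇ᵤ∇ᵥ∂ᵥ - ∇ᵥ∇ᵤ∂ᵥ` for the Levi-Civita
connection `∇` of `A`. -/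
def curvatureComponent (A : FormField S) (φ : OpenPartialHomeomorph S E2) (l : Fin 2)
    (x : E2) : ℝ :=
  pd 0 (christoffel A φ l 1 1) x - pd 1 (christoffel A φ l 0 1) x
    + ∑ m, (christoffel A φ m 1 1 x * christoffel A φ l 0 m x
      - christoffel A φ m 0 1 x * christoffel A φ l 1 m x)

/-- The Gaussian curvature `A(R(∂ᵤ, ∂ᵥ)∂ᵥ, ∂ᵤ) / (EG - F²)` of `A`, computed in `φ`. -/
def gaussianCurvatureIn (A : FormField S) (φ : OpenPartialHomeomorph S E2) (x : E2) : ℝ :=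
  (∑ l, coeff A φ x l 0 * curvatureComponent A φ l x) / (coeff A φ x).det

/-- The Gaussian curvature of the metric `A` at `p`. It does not depend on the chart;
the preferred chart at `p` is used. -/
def gaussianCurvature (A : FormField S) (p : S) : ℝ :=
  gaussianCurvatureIn A (chartAt E2 p) (chartAt E2 p p)

/-- The extrinsic curvature `K(A,B) = (eg - f²) / (EG - F²)` of a pair, computed in `φ`. -/
def extrinsicCurvatureIn (A B : FormField S) (φ : OpenPartialHomeomorph S E2) (x : E2) : ℝ :=
  (coeff B φ x).det / (coeff A φ x).det

/-- `A` is a (smooth) Riemannian metric on `S`. -/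
def IsRiemannianMetric [IsManifold (𝓡 2) ∞ S] (A : FormField S) : Prop :=
  ∃ g : Bundle.ContMDiffRiemannianMetric (𝓡 2) ∞ E2 (fun p : S => TangentSpace (𝓡 2) p),
    ∀ (p : S) (v w : TangentSpace (𝓡 2) p), g.inner p v w = A p v w

/-- `B` is a (smooth) real quadratic form on `S`, given by its polarization. -/
structure IsSmoothQuadraticForm (B : FormField S) : Prop where
  symm : ∀ (p : S) (v w : TangentSpace (𝓡 2) p), B p v w = B p w v
  smooth : ∀ φ ∈ IsManifold.maximalAtlas (𝓡 2) ∞ S, ∀ i j,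
    ContDiffOn ℝ ∞ (fun x => coeff B φ x i j) φ.target

/-- `(A, B)` is a Codazzi pair: `A` is a Riemannian metric, `B` a quadratic form, and the
classical Codazzi equations hold in all local parameters. -/
structure IsCodazziPair [IsManifold (𝓡 2) ∞ S] (A B : FormField S) : Prop where
  metric : IsRiemannianMetric A
  form : IsSmoothQuadraticForm B
  codazzi₁ : ∀ φ ∈ IsManifold.maximalAtlas (𝓡 2) ∞ S, ∀ x ∈ φ.target,
    pd 1 (fun y => coeff B φ y 0 0) x - pd 0 (fun y => coeff B φ y 0 1) x
      = coeff B φ x 0 0 * christoffel A φ 0 0 1 x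
        + coeff B φ x 0 1 * (christoffel A φ 1 0 1 x - christoffel A φ 0 0 0 x)
        - coeff B φ x 1 1 * christoffel A φ 1 0 0 x
  codazzi₂ : ∀ φ ∈ IsManifold.maximalAtlas (𝓡 2) ∞ S, ∀ x ∈ φ.target,
    pd 1 (fun y => coeff B φ y 0 1) x - pd 0 (fun y => coeff B φ y 1 1) x
      = coeff B φ x 0 0 * christoffel A φ 0 1 1 x
        + coeff B φ x 0 1 * (christoffel A φ 1 1 1 x - christoffel A φ 0 0 1 x)
        - coeff B φ x 1 1 * christoffel A φ 1 0 1 x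

/-! ### Immersed surfaces in `M²(ε) × ℝ` -/

/-- The differential of an `ℝ⁴`-valued map on `S`. -/
def diff (f : S → E4) (p : S) : TangentSpace (𝓡 2) p →ₗ[ℝ] E4 :=
  (mfderiv (𝓡 2) 𝓘(ℝ, E4) f p).toLinearMap

/-- `ψ` is a smooth immersion of `S` into `M²(ε) × ℝ`. -/
structure IsImmersionInto (ε : ℝ) (ψ : S → E4) : Prop where
  smooth : ContMDiff (𝓡 2) 𝓘(ℝ, E4) ∞ ψ
  mem : ∀ p, ψ p ∈ productSpace ε
  injective : ∀ p, Function.Injective (diff ψ p)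

/-- `N` is a smooth unit normal vector field of `ψ` in `M²(ε) × ℝ`: it is tangent to
`M²(ε) × ℝ`, orthogonal to the surface, and of length one. -/
structure IsUnitNormal (ε : ℝ) (ψ N : S → E4) : Prop where
  smooth : ContMDiff (𝓡 2) 𝓘(ℝ, E4) ∞ N
  tangent : ∀ p, ambient ε (N p) (eta (ψ p)) = 0
  normal : ∀ (p : S) (v : TangentSpace (𝓡 2) p), ambient ε (N p) (diff ψ p v) = 0
  unit : ∀ p, ambient ε (N p) (N p) = 1

/-- First fundamental form `I = ⟨dψ, dψ⟩`. -/
def firstForm (ε : ℝ) (ψ : S → E4) : FormField S :=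
  fun p => (ambient ε).compl₁₂ (diff ψ p) (diff ψ p)

/-- Second fundamental form `II = ⟨-dN, dψ⟩`. -/
def secondForm (ε : ℝ) (ψ N : S → E4) : FormField S :=
  fun p => (ambient ε).compl₁₂ (-diff N p) (diff ψ p)

/-- The height function, i.e. the last coordinate of `ψ`. -/
def height (ψ : S → E4) : S → ℝ := fun p => ψ p 3

/-- The differential `dh` of the height function. -/
def dheight (ψ : S → E4) (p : S) : TangentSpace (𝓡 2) p →ₗ[ℝ] ℝ :=
  (mfderiv (𝓡 2) 𝓘(ℝ, ℝ) (height ψ) p).toLinearMap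

/-- The quadratic form `A = I + (1 / (ε K(I) - 1)) dh²`, where `K(I)` is the Gaussian
curvature of `I`. -/
def modifiedForm (ε : ℝ) (ψ : S → E4) : FormField S :=
  fun p => firstForm ε ψ p
    + (1 / (ε * gaussianCurvature (firstForm ε ψ) p - 1)) •
      (LinearMap.mul ℝ ℝ).compl₁₂ (dheight ψ p) (dheight ψ p)

end Surface

end ProductSurface

end

/-!
In local parameters write `Y` for the immersion, `n` for the unit normal, `a` and `b` for the
coefficients of `I` and `II`, `hᵢ` for the derivatives of the height and `ν = n₃` for the angle
function. The vectors `∂ᵤY, ∂ᵥY, n, η` form a basis of `ℝ⁴`, and in this basis the second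
derivatives of `Y` are given by the Gauss formula (`IsLocalImmersion.gauss_formula`)
`∂ᵢ∂ⱼY = ∑ₖ Γᵢⱼᵏ ∂ₖY + bᵢⱼ n - ε (aᵢⱼ - hᵢ hⱼ) η`.
Four facts follow from the formula and the basis.

* Its last coordinate says that the Hessian of the height is `ν II` (`partialDeriv₂_height`).
  Hence for `A = I + c dh²` the Levi-Civita connection of `A` is that of `I` plus
  `c ν II ⊗ ∇h`, with the gradient taken with respect to `A` (`christoffelOf_modified`).
* Symmetry of `∂∂n` gives the Codazzi equation of `II` with respect to `I`, with the extra term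
  `-ε ν (I ∧ dh)` (`codazzi`).
* Symmetry of `∂∂∂Y` gives the Gauss equation `det b = (K - ε ν²) det a` (`gauss_equation`,
  `det_secondForm`).
* Expanding the vertical vector in the basis gives `1 = |∇h|² + ν²`
  (`det_eq_gradient_add_angle`), hence `(K - ε) det A = (K - ε ν²) det a` for
  `c = 1 / (εK - 1) = ε / (K - ε)` (`det_modified`).

The last two facts give `det b = (K - ε) det A`. Passing from `I` to `A` in the Codazzi equation
adds a multiple of `c det b / det A = ε`, which cancels the extra term exactly
(`codazzi_modified`).

The Gaussian curvature is given in the preferred chart of each point, whereas the conclusion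
concerns all charts. Its invariance is not needed: only the relation
`det b = (K - ε ν²) det a` has to be moved to another chart, and both determinants change by the
same factor (`det_coeff_eq`).
-/

noncomputable section

namespace ProductSurface

/-! ### Partial derivatives of vector-valued functions -/

section Calculus

variable {F : Type*} [NormedAddCommGroup F] [NormedSpace ℝ F]

/-- Partial derivative of a vector-valued function of the two parameters; for real-valued
functions this is `pd`. -/
def partialDeriv (i : Fin 2) (f : E2 → F) (x : E2) : F := fderiv ℝ f x (e i)

theorem pd_eq_partialDeriv (i : Fin 2) (f : E2 → ℝ) (x : E2) :
    pd i f x = partialDeriv i f x := rfl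

theorem partialDeriv_congr {U : Set E2} (hU : IsOpen U) {f g : E2 → F}
    (h : ∀ x ∈ U, f x = g x) (i : Fin 2) {x : E2} (hx : x ∈ U) :
    partialDeriv i f x = partialDeriv i g x := by
  have : f =ᶠ[nhds x] g := Filter.eventually_of_mem (hU.mem_nhds hx) h
  simp only [partialDeriv, this.fderiv_eq]

theorem contDiffOn_partialDeriv {U : Set E2} (hU : IsOpen U) {f : E2 → F}
    (hf : ContDiffOn ℝ ∞ f U) (i : Fin 2) : ContDiffOn ℝ ∞ (partialDeriv i f) U :=
  (hf.fderiv_of_isOpen hU (by simp)).clm_apply contDiffOn_const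

theorem differentiableAt_of_contDiffOn {U : Set E2} (hU : IsOpen U) {f : E2 → F}
    (hf : ContDiffOn ℝ ∞ f U) {x : E2} (hx : x ∈ U) : DifferentiableAt ℝ f x :=
  (hf.contDiffAt (hU.mem_nhds hx)).differentiableAt (by simp)

theorem partialDeriv_comm {U : Set E2} (hU : IsOpen U) {f : E2 → F}
    (hf : ContDiffOn ℝ ∞ f U) (i j : Fin 2) {x : E2} (hx : x ∈ U) :
    partialDeriv i (partialDeriv j f) x = partialDeriv j (partialDeriv i f) x := by
  have hd : DifferentiableAt ℝ (fderiv ℝ f) x :=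
    differentiableAt_of_contDiffOn hU (hf.fderiv_of_isOpen hU (by simp)) hx
  have hs : IsSymmSndFDerivAt ℝ f x :=
    (hf.contDiffAt (hU.mem_nhds hx)).isSymmSndFDerivAt
      (by simpa using WithTop.coe_le_coe.2 (le_top : (2 : ℕ∞) ≤ ⊤))
  have key : ∀ i j : Fin 2,
      partialDeriv i (partialDeriv j f) x = fderiv ℝ (fderiv ℝ f) x (e i) (e j) := by
    intro i j
    have : HasFDerivAt (partialDeriv j f) ((fderiv ℝ (fderiv ℝ f) x).flip (e j)) x := by
      have h := hd.hasFDerivAt.clm_apply (hasFDerivAt_const (e j) x)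
      simp only [ContinuousLinearMap.comp_zero, zero_add] at h
      exact h
    rw [partialDeriv, this.fderiv]
    rfl
  rw [key, key, hs.eq]

theorem partialDeriv_neg (f : E2 → F) (x : E2) (i : Fin 2) :
    partialDeriv i (fun y => -f y) x = -partialDeriv i f x := by
  simp [partialDeriv, fderiv_fun_neg]

theorem partialDeriv_mul_add_mul {a b c d : E2 → ℝ} {x : E2} (ha : DifferentiableAt ℝ a x)
    (hb : DifferentiableAt ℝ b x) (hc : DifferentiableAt ℝ c x) (hd : DifferentiableAt ℝ d x)
    (i : Fin 2) :
    partialDeriv i (fun y => a y * b y + c y * d y) x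
      = partialDeriv i a x * b x + a x * partialDeriv i b x
        + (partialDeriv i c x * d x + c x * partialDeriv i d x) := by
  simp only [partialDeriv]
  rw [fderiv_fun_add (ha.fun_mul hb) (hc.fun_mul hd), fderiv_fun_mul ha hb, fderiv_fun_mul hc hd]
  simp
  ring

theorem partialDeriv_add_const_mul {a b d : E2 → ℝ} {x : E2} (ha : DifferentiableAt ℝ a x)
    (hb : DifferentiableAt ℝ b x) (hd : DifferentiableAt ℝ d x) (c : ℝ) (i : Fin 2) :
    partialDeriv i (fun y => a y + c * (b y * d y)) x
      = partialDeriv i a x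
        + c * (partialDeriv i b x * d x + b x * partialDeriv i d x) := by
  simp only [partialDeriv]
  rw [fderiv_fun_add ha ((hb.fun_mul hd).const_mul c), fderiv_const_mul (hb.fun_mul hd),
    fderiv_fun_mul hb hd]
  simp
  ring

theorem partialDeriv_coord {f : E2 → E4} {x : E2} (hf : DifferentiableAt ℝ f x)
    (i : Fin 2) (k : Fin 4) :
    partialDeriv i (fun y => f y k) x = partialDeriv i f x k := by
  have := (EuclideanSpace.proj (𝕜 := ℝ) k).hasFDerivAt.comp x hf.hasFDerivAt
  change fderiv ℝ ((EuclideanSpace.proj (𝕜 := ℝ) k) ∘ f) x (e i) = _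
  rw [this.fderiv]
  rfl

end Calculus

/-! ### The ambient metric -/

theorem ambient_apply (ε : ℝ) (x y : E4) :
    ambient ε x y = ε * x 0 * y 0 + x 1 * y 1 + x 2 * y 2 + x 3 * y 3 := rfl

theorem ambient_comm (ε : ℝ) (x y : E4) : ambient ε x y = ambient ε y x := by
  simp only [ambient_apply]; ring

theorem ambient_eta_left (ε : ℝ) (x y : E4) :
    ambient ε (eta x) y = ambient ε x y - x 3 * y 3 := by
  simp [ambient_apply, eta]

/-- The ambient metric as a continuous bilinear map, for use with the product rule. -/
def ambientCLM (ε : ℝ) : E4 →L[ℝ] E4 →L[ℝ] ℝ :=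
  LinearMap.toContinuousLinearMap
    ((LinearMap.toContinuousLinearMap : (E4 →ₗ[ℝ] ℝ) ≃ₗ[ℝ] (E4 →L[ℝ] ℝ)).toLinearMap ∘ₗ ambient ε)

theorem ambientCLM_apply (ε : ℝ) (x y : E4) : ambientCLM ε x y = ambient ε x y := rfl

theorem partialDeriv_ambient (ε : ℝ) {f g : E2 → E4} {x : E2} (hf : DifferentiableAt ℝ f x)
    (hg : DifferentiableAt ℝ g x) (i : Fin 2) :
    partialDeriv i (fun y => ambient ε (f y) (g y)) x
      = ambient ε (partialDeriv i f x) (g x) + ambient ε (f x) (partialDeriv i g x) := by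
  have := (ambientCLM ε).hasFDerivAt_of_bilinear hf.hasFDerivAt hg.hasFDerivAt
  change fderiv ℝ (fun y => ambientCLM ε (f y) (g y)) x (e i) = _
  rw [this.fderiv]
  simp [partialDeriv, ambientCLM_apply, add_comm]

theorem contDiffOn_ambient (ε : ℝ) {f g : E2 → E4} {U : Set E2} (hf : ContDiffOn ℝ ∞ f U)
    (hg : ContDiffOn ℝ ∞ g U) : ContDiffOn ℝ ∞ (fun y => ambient ε (f y) (g y)) U :=
  ((ambientCLM ε).contDiff.comp_contDiffOn hf).clm_apply hg

/-- `eta` is linear; this is its continuous linear version. -/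
def etaCLM : E4 →L[ℝ] E4 :=
  LinearMap.toContinuousLinearMap
    { toFun := eta
      map_add' := by intro x y; ext k; fin_cases k <;> simp [eta]
      map_smul' := by intro c x; ext k; fin_cases k <;> simp [eta] }

theorem contDiffOn_eta {f : E2 → E4} {U : Set E2} (hf : ContDiffOn ℝ ∞ f U) :
    ContDiffOn ℝ ∞ (fun y => eta (f y)) U :=
  etaCLM.contDiff.comp_contDiffOn hf

theorem partialDeriv_eta {f : E2 → E4} {x : E2} (hf : DifferentiableAt ℝ f x) (i : Fin 2) :
    partialDeriv i (fun y => eta (f y)) x = eta (partialDeriv i f x) := by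
  have := etaCLM.hasFDerivAt.comp x hf.hasFDerivAt
  change fderiv ℝ (etaCLM ∘ f) x (e i) = _
  rw [this.fderiv]
  rfl

/-- Two vectors with non-degenerate Gram matrix, together with a unit vector `n` and a vector
`w` of square `ε`, all mutually orthogonal, form a basis of `ℝ⁴`; so only `0` is orthogonal to
all four. -/
theorem eq_zero_of_orthogonal_frame {ε : ℝ} (hε : ε ≠ 0) {a b n w z : E4}
    (hab : ambient ε a a * ambient ε b b - ambient ε a b * ambient ε a b ≠ 0)
    (hna : ambient ε n a = 0) (hnb : ambient ε n b = 0) (hnw : ambient ε n w = 0)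
    (hnn : ambient ε n n = 1) (haw : ambient ε a w = 0) (hbw : ambient ε b w = 0)
    (hww : ambient ε w w = ε)
    (hza : ambient ε z a = 0) (hzb : ambient ε z b = 0) (hzn : ambient ε z n = 0)
    (hzw : ambient ε z w = 0) : z = 0 := by
  have key : ∀ c : Fin 4 → ℝ, (∀ y ∈ ({a, b, n, w} : Set E4),
      ambient ε (c 0 • a + c 1 • b + c 2 • n + c 3 • w) y = 0) → c = 0 := by
    intro c hc
    have h1 := hc a (by simp)
    have h2 := hc b (by simp)
    have h3 := hc n (by simp)
    have h4 := hc w (by simp)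
    simp only [map_add, map_smul, LinearMap.add_apply, LinearMap.smul_apply, smul_eq_mul,
      ambient_comm ε w, ambient_comm ε b a, ambient_comm ε a n, ambient_comm ε b n,
      hna, hnb, hnw, hnn, haw, hbw, hww] at h1 h2 h3 h4
    have c3 : c 3 = 0 := by
      have : c 3 * ε = 0 := by linarith
      exact (mul_eq_zero.1 this).resolve_right hε
    have c0 : c 0 = 0 := by
      refine (mul_eq_zero.1 ?_).resolve_right hab
      linear_combination ambient ε b b * h1 - ambient ε a b * h2
    have c1 : c 1 = 0 := by
      refine (mul_eq_zero.1 ?_).resolve_right hab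
      linear_combination ambient ε a a * h2 - ambient ε a b * h1
    funext k
    fin_cases k
    · exact c0
    · exact c1
    · simpa using h3
    · exact c3
  have hli : LinearIndependent ℝ ![a, b, n, w] := by
    rw [Fintype.linearIndependent_iff]
    intro c hc
    have : c = 0 := by
      apply key
      intro y _
      have : c 0 • a + c 1 • b + c 2 • n + c 3 • w = 0 := by
        simpa [Fin.sum_univ_four] using hc
      rw [this]; simp
    simp [this]
  have hspan := hli.span_eq_top_of_card_eq_finrank (by simp)
  have hz : z ∈ Submodule.span ℝ (Set.range ![a, b, n, w]) := by rw [hspan]; trivial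
  obtain ⟨c, hc⟩ := (Submodule.mem_span_range_iff_exists_fun ℝ).1 hz
  have hc' : c 0 • a + c 1 • b + c 2 • n + c 3 • w = z := by
    simpa [Fin.sum_univ_four] using hc
  have : c = 0 := by
    apply key
    rw [hc']
    rintro y (rfl | rfl | rfl | rfl) <;> assumption
  rw [← hc', this]
  simp

/-- Vectors tangent to `M²(ε) × ℝ` are spacelike, also in the Lorentzian case `ε = -1`. -/
theorem ambient_self_pos {ε : ℝ} (hε : ε = 1 ∨ ε = -1) {x v : E4} (hx : x ∈ productSpace ε)
    (hv : ambient ε v (eta x) = 0) (hv0 : v ≠ 0) : 0 < ambient ε v v := by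
  obtain ⟨hx, -⟩ := hx
  have hne : ¬ (v 0 = 0 ∧ v 1 = 0 ∧ v 2 = 0 ∧ v 3 = 0) := by
    rintro ⟨h0, h1, h2, h3⟩
    apply hv0
    ext k
    fin_cases k <;> assumption
  rcases hε with rfl | rfl
  · simp only [ambient_apply]
    contrapose! hne
    refine ⟨?_, ?_, ?_, ?_⟩ <;> nlinarith [sq_nonneg (v 0), sq_nonneg (v 1), sq_nonneg (v 2),
      sq_nonneg (v 3)]
  · simp only [ambient_apply, eta] at hv ⊢
    simp at hv
    have hv' : x 0 * v 0 = x 1 * v 1 + x 2 * v 2 := by linarith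
    have hx' : x 0 ^ 2 = 1 + x 1 ^ 2 + x 2 ^ 2 := by linarith
    -- Lagrange's identity in the plane of the coordinates `1, 2`.
    have key : x 0 ^ 2 * (-(v 0) ^ 2 + v 1 ^ 2 + v 2 ^ 2 + v 3 ^ 2)
        = v 1 ^ 2 + v 2 ^ 2 + (x 1 * v 2 - x 2 * v 1) ^ 2 + x 0 ^ 2 * v 3 ^ 2 := by
      have : x 0 ^ 2 * v 0 ^ 2 = (x 1 * v 1 + x 2 * v 2) ^ 2 := by rw [← hv']; ring
      linear_combination -this + (v 1 ^ 2 + v 2 ^ 2) * hx'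
    have hx0 : 0 < x 0 ^ 2 := by nlinarith [sq_nonneg (x 1), sq_nonneg (x 2)]
    have hpos : 0 < x 0 ^ 2 * (-(v 0) ^ 2 + v 1 ^ 2 + v 2 ^ 2 + v 3 ^ 2) := by
      rw [key]
      by_contra hcon
      have h3 : 0 ≤ x 0 ^ 2 * v 3 ^ 2 := by positivity
      have h1 : v 1 = 0 := by
        nlinarith [sq_nonneg (v 1), sq_nonneg (v 2), sq_nonneg (x 1 * v 2 - x 2 * v 1)]
      have h2 : v 2 = 0 := by
        nlinarith [sq_nonneg (v 1), sq_nonneg (v 2), sq_nonneg (x 1 * v 2 - x 2 * v 1)]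
      have h3' : x 0 ^ 2 * v 3 ^ 2 = 0 := by
        nlinarith [sq_nonneg (v 1), sq_nonneg (v 2), sq_nonneg (x 1 * v 2 - x 2 * v 1)]
      have h4 : v 3 = 0 := by
        rcases mul_eq_zero.1 h3' with h | h
        · exact absurd h hx0.ne'
        · simpa using h
      have h0 : v 0 = 0 := by
        rw [h1, h2] at hv'
        have : x 0 ≠ 0 := by rintro h; simp [h] at hx0
        simpa [this] using hv'
      exact hne ⟨h0, h1, h2, h4⟩
    have := (mul_pos_iff_of_pos_left hx0).1 hpos
    linarith

/-- The Gram determinant of two vectors spanning a positive definite plane is positive. -/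
theorem gram_det_pos {V : Type*} [AddCommGroup V] [Module ℝ V] (B : LinearMap.BilinForm ℝ V)
    {v w : V} (hvw : B v w = B w v)
    (hpos : ∀ s t : ℝ, (s ≠ 0 ∨ t ≠ 0) → 0 < B (s • v + t • w) (s • v + t • w)) :
    0 < B v v * B w w - B v w * B w v := by
  have h1 : 0 < B v v := by simpa using hpos 1 0 (by simp)
  have h2 := hpos (-B v w) (B v v) (Or.inr h1.ne')
  simp only [map_add, map_smul, LinearMap.add_apply, LinearMap.smul_apply, smul_eq_mul] at h2
  rw [← hvw] at h2 ⊢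
  have h3 : 0 < B v v * (B v v * B w w - B v w * B v w) := by linarith
  exact (mul_pos_iff_of_pos_left h1).1 h3


/-! ### Christoffel symbols of a matrix-valued function of two parameters -/

section Christoffel

/-- The Christoffel symbols of the second kind of the metric with coefficients `a`; for
`a = coeff A φ` they are `christoffel A φ`. -/
def christoffelOf (a : E2 → Matrix (Fin 2) (Fin 2) ℝ) (k i j : Fin 2) (x : E2) : ℝ :=
  (1 / 2) * ∑ l, (a x)⁻¹ k l *
    (pd i (fun y => a y j l) x + pd j (fun y => a y i l) x - pd l (fun y => a y i j) x)

/-- The Christoffel symbols of the first kind of the metric with coefficients `a`. -/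
def firstKind (a : E2 → Matrix (Fin 2) (Fin 2) ℝ) (i j l : Fin 2) (x : E2) : ℝ :=
  (1 / 2) *
    (pd i (fun y => a y j l) x + pd j (fun y => a y i l) x - pd l (fun y => a y i j) x)

variable {a : E2 → Matrix (Fin 2) (Fin 2) ℝ} {x : E2}

theorem christoffelOf_eq_mulVec (a : E2 → Matrix (Fin 2) (Fin 2) ℝ) (k i j : Fin 2) (x : E2) :
    christoffelOf a k i j x = (a x)⁻¹.mulVec (fun l => firstKind a i j l x) k := by
  simp only [christoffelOf, firstKind, Matrix.mulVec, dotProduct, Finset.mul_sum]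
  exact Finset.sum_congr rfl fun l _ => by ring

/-- Lowering the upper index of the symbols of the second kind. -/
theorem mulVec_christoffelOf (hdet : (a x).det ≠ 0) (i j l : Fin 2) :
    a x l 0 * christoffelOf a 0 i j x + a x l 1 * christoffelOf a 1 i j x
      = firstKind a i j l x := by
  have h : (a x).mulVec (fun k => christoffelOf a k i j x) = fun l => firstKind a i j l x := by
    simp only [christoffelOf_eq_mulVec]
    change (a x).mulVec ((a x)⁻¹.mulVec _) = _
    rw [Matrix.mulVec_mulVec, Matrix.mul_nonsing_inv _ (isUnit_iff_ne_zero.2 hdet),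
      Matrix.one_mulVec]
  simpa [Matrix.mulVec, dotProduct, Fin.sum_univ_two] using congrFun h l

/-- The symbols of the second kind are characterized by their lowered version. -/
theorem christoffelOf_unique (hdet : (a x).det ≠ 0) {i j : Fin 2} {γ : Fin 2 → ℝ}
    (h : ∀ l, a x l 0 * γ 0 + a x l 1 * γ 1 = firstKind a i j l x) (k : Fin 2) :
    christoffelOf a k i j x = γ k := by
  have hv : (fun l => firstKind a i j l x) = (a x).mulVec γ := by
    funext l
    simp [Matrix.mulVec, dotProduct, Fin.sum_univ_two, ← h l]
  rw [christoffelOf_eq_mulVec, hv, Matrix.mulVec_mulVec,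
    Matrix.nonsing_inv_mul _ (isUnit_iff_ne_zero.2 hdet), Matrix.one_mulVec]

theorem contDiffOn_christoffelOf {U : Set E2} (hU : IsOpen U)
    (ha : ∀ i j, ContDiffOn ℝ ∞ (fun y => a y i j) U) (hdet : ∀ y ∈ U, (a y).det ≠ 0)
    (k i j : Fin 2) : ContDiffOn ℝ ∞ (christoffelOf a k i j) U := by
  have hd : ContDiffOn ℝ ∞ (fun y => (a y).det) U := by
    simp only [Matrix.det_fin_two]
    exact ((ha 0 0).mul (ha 1 1)).sub ((ha 0 1).mul (ha 1 0))
  have hinv : ∀ k l, ContDiffOn ℝ ∞ (fun y => (a y)⁻¹ k l) U := by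
    intro k l
    have hadj : ContDiffOn ℝ ∞ (fun y => (a y).adjugate k l) U := by
      simp only [Matrix.adjugate_fin_two]
      fin_cases k <;> fin_cases l
      · exact ha 1 1
      · exact (ha 0 1).neg
      · exact (ha 1 0).neg
      · exact ha 0 0
    simp only [Matrix.inv_def, Ring.inverse_eq_inv', Matrix.smul_apply, smul_eq_mul]
    exact (hd.inv hdet).mul hadj
  have hpd : ∀ i k l, ContDiffOn ℝ ∞ (fun y => pd i (fun z => a z k l) y) U :=
    fun i k l => contDiffOn_partialDeriv hU (ha k l) i
  exact contDiffOn_const.mul (ContDiffOn.sum fun l _ =>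
    (hinv k l).mul (((hpd i j l).add (hpd j i l)).sub (hpd l i j)))

end Christoffel

/-! ### Immersions of plane domains into the product space -/

/-- A parametrized surface `Y` in `M²(ε) × ℝ` over an open set `U` of the parameter plane, with
unit normal `n`, coefficients `a` of the first fundamental form and `b` of the second. The
coefficients are only constrained on `U`. -/
structure IsLocalImmersion (ε : ℝ) (U : Set E2) (Y n : E2 → E4)
    (a b : E2 → Matrix (Fin 2) (Fin 2) ℝ) : Prop where
  eps : ε = 1 ∨ ε = -1
  isOpen : IsOpen U
  smooth : ContDiffOn ℝ ∞ Y U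
  smooth_normal : ContDiffOn ℝ ∞ n U
  mem : ∀ x ∈ U, Y x ∈ productSpace ε
  indep : ∀ x ∈ U, ∀ s t : ℝ, s • partialDeriv 0 Y x + t • partialDeriv 1 Y x = 0 →
    s = 0 ∧ t = 0
  tangent : ∀ x ∈ U, ambient ε (n x) (eta (Y x)) = 0
  normal : ∀ x ∈ U, ∀ i, ambient ε (n x) (partialDeriv i Y x) = 0
  unit : ∀ x ∈ U, ambient ε (n x) (n x) = 1
  first : ∀ x ∈ U, ∀ i j, a x i j = ambient ε (partialDeriv i Y x) (partialDeriv j Y x)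
  second : ∀ x ∈ U, ∀ i j, b x i j = -ambient ε (partialDeriv i n x) (partialDeriv j Y x)

namespace IsLocalImmersion

variable {ε : ℝ} {U : Set E2} {Y n : E2 → E4} {a b : E2 → Matrix (Fin 2) (Fin 2) ℝ}
  (h : IsLocalImmersion ε U Y n a b) {x : E2} (hx : x ∈ U)

include h

theorem sq : ε * ε = 1 := by
  rcases h.eps with rfl | rfl <;> norm_num

theorem ambient_eta_eta : ∀ y ∈ U, ambient ε (eta (Y y)) (eta (Y y)) = ε := by
  intro y hy
  simp only [ambient_apply, eta]
  simp
  linear_combination (h.mem y hy).1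

theorem smooth_partialDeriv (i : Fin 2) : ContDiffOn ℝ ∞ (partialDeriv i Y) U :=
  contDiffOn_partialDeriv h.isOpen h.smooth i

theorem smooth_first (i j : Fin 2) : ContDiffOn ℝ ∞ (fun y => a y i j) U :=
  (contDiffOn_ambient ε (h.smooth_partialDeriv i) (h.smooth_partialDeriv j)).congr
    fun y hy => h.first y hy i j

theorem smooth_second (i j : Fin 2) : ContDiffOn ℝ ∞ (fun y => b y i j) U :=
  (contDiffOn_ambient ε (contDiffOn_partialDeriv h.isOpen h.smooth_normal i)
    (h.smooth_partialDeriv j)).neg.congr fun y hy => h.second y hy i j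

include hx

theorem differentiableAt {F : Type*} [NormedAddCommGroup F] [NormedSpace ℝ F] {f : E2 → F}
    (hf : ContDiffOn ℝ ∞ f U) : DifferentiableAt ℝ f x :=
  differentiableAt_of_contDiffOn h.isOpen hf hx

theorem first_symm (i j : Fin 2) : a x i j = a x j i := by
  rw [h.first x hx, h.first x hx, ambient_comm]

/-- Differentiating a relation `⟨f, g⟩ = c` which holds on `U`. -/
theorem ambient_partialDeriv_add {f g : E2 → E4} (hf : ContDiffOn ℝ ∞ f U)
    (hg : ContDiffOn ℝ ∞ g U) {c : ℝ} (hc : ∀ y ∈ U, ambient ε (f y) (g y) = c) (i : Fin 2) :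
    ambient ε (partialDeriv i f x) (g x) + ambient ε (f x) (partialDeriv i g x) = 0 := by
  rw [← partialDeriv_ambient ε (h.differentiableAt hx hf) (h.differentiableAt hx hg),
    partialDeriv_congr h.isOpen hc i hx]
  simp [partialDeriv]

theorem ambient_partialDeriv_eta (i : Fin 2) :
    ambient ε (partialDeriv i Y x) (eta (Y x)) = 0 := by
  have h1 := h.ambient_partialDeriv_add hx (contDiffOn_eta h.smooth) (contDiffOn_eta h.smooth)
    h.ambient_eta_eta i
  rw [partialDeriv_eta (h.differentiableAt hx h.smooth), ambient_eta_left,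
    ambient_comm ε (eta (Y x)), ambient_eta_left] at h1
  have h2 : eta (Y x) 3 = 0 := by simp [eta]
  rw [h2] at h1
  linarith

theorem det_ne : (a x).det ≠ 0 := by
  have hpos := gram_det_pos (ambient ε) (v := partialDeriv 0 Y x) (w := partialDeriv 1 Y x)
    (ambient_comm ε _ _) (fun s t hst => by
      refine ambient_self_pos h.eps (h.mem x hx) ?_ fun h0 => ?_
      · simp [h.ambient_partialDeriv_eta hx]
      · obtain ⟨hs, ht⟩ := h.indep x hx s t h0
        simp [hs, ht] at hst)
  rw [Matrix.det_fin_two, h.first x hx, h.first x hx, h.first x hx, h.first x hx]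
  exact hpos.ne'

/-- The `η`-component of the second derivatives of the immersion. -/
theorem ambient_partialDeriv₂_eta (i j : Fin 2) :
    ambient ε (partialDeriv i (partialDeriv j Y) x) (eta (Y x))
      = -(a x i j - partialDeriv i Y x 3 * partialDeriv j Y x 3) := by
  have h1 := h.ambient_partialDeriv_add hx (h.smooth_partialDeriv j) (contDiffOn_eta h.smooth)
    (fun y hy => h.ambient_partialDeriv_eta hy j) i
  rw [partialDeriv_eta (h.differentiableAt hx h.smooth), ambient_comm ε (partialDeriv j Y x),
    ambient_eta_left, ← h.first x hx] at h1
  linarith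

/-- The normal component of the second derivatives of the immersion. -/
theorem ambient_partialDeriv₂_normal (i j : Fin 2) :
    ambient ε (partialDeriv i (partialDeriv j Y) x) (n x) = b x i j := by
  have h1 := h.ambient_partialDeriv_add hx h.smooth_normal (h.smooth_partialDeriv j)
    (fun y hy => h.normal y hy j) i
  rw [ambient_comm ε (n x)] at h1
  rw [h.second x hx]
  linarith

theorem second_symm (i j : Fin 2) : b x i j = b x j i := by
  rw [← h.ambient_partialDeriv₂_normal hx, ← h.ambient_partialDeriv₂_normal hx,
    partialDeriv_comm h.isOpen h.smooth i j hx]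

theorem ambient_partialDeriv_normal_self (i : Fin 2) :
    ambient ε (n x) (partialDeriv i n x) = 0 := by
  have h1 := h.ambient_partialDeriv_add hx h.smooth_normal h.smooth_normal h.unit i
  rw [ambient_comm ε (partialDeriv i n x)] at h1
  linarith

theorem ambient_eta_partialDeriv_normal (i : Fin 2) :
    ambient ε (eta (Y x)) (partialDeriv i n x) = n x 3 * partialDeriv i Y x 3 := by
  have h1 := h.ambient_partialDeriv_add hx h.smooth_normal (contDiffOn_eta h.smooth)
    h.tangent i
  rw [partialDeriv_eta (h.differentiableAt hx h.smooth), ambient_comm ε (n x),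
    ambient_eta_left, ambient_comm ε (partialDeriv i Y x), h.normal x hx, ambient_comm] at h1
  linarith

theorem pd_first (k i j : Fin 2) :
    pd k (fun y => a y i j) x
      = ambient ε (partialDeriv k (partialDeriv i Y) x) (partialDeriv j Y x)
        + ambient ε (partialDeriv i Y x) (partialDeriv k (partialDeriv j Y) x) := by
  rw [pd_eq_partialDeriv, partialDeriv_congr h.isOpen (fun y hy => h.first y hy i j) k hx,
    partialDeriv_ambient ε (h.differentiableAt hx (h.smooth_partialDeriv i))
      (h.differentiableAt hx (h.smooth_partialDeriv j))]

/-- The tangential component of the second derivatives: symbols of the first kind. -/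
theorem firstKind_first (i j l : Fin 2) :
    firstKind a i j l x
      = ambient ε (partialDeriv i (partialDeriv j Y) x) (partialDeriv l Y x) := by
  rw [firstKind, h.pd_first hx, h.pd_first hx, h.pd_first hx,
    partialDeriv_comm h.isOpen h.smooth j i hx, partialDeriv_comm h.isOpen h.smooth l i hx,
    partialDeriv_comm h.isOpen h.smooth l j hx,
    ambient_comm ε (partialDeriv i Y x), ambient_comm ε (partialDeriv j Y x)]
  ring

theorem ambient_partialDeriv₂_tangent (i j l : Fin 2) :
    ambient ε (partialDeriv i (partialDeriv j Y) x) (partialDeriv l Y x)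
      = a x l 0 * christoffelOf a 0 i j x + a x l 1 * christoffelOf a 1 i j x := by
  rw [mulVec_christoffelOf (h.det_ne hx), h.firstKind_first hx]

/-- A vector orthogonal to the frame `∂ᵤY, ∂ᵥY, n, η` vanishes. -/
theorem eq_zero_of_orthogonal {z : E4} (hz : ∀ i, ambient ε z (partialDeriv i Y x) = 0)
    (hzn : ambient ε z (n x) = 0) (hzη : ambient ε z (eta (Y x)) = 0) : z = 0 := by
  have hε : ε ≠ 0 := by
    rintro rfl
    simpa using h.sq
  have hd := h.det_ne hx
  rw [Matrix.det_fin_two, h.first_symm hx 1 0, h.first x hx, h.first x hx, h.first x hx] at hd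
  exact eq_zero_of_orthogonal_frame hε hd (h.normal x hx 0) (h.normal x hx 1)
    (h.tangent x hx) (h.unit x hx) (h.ambient_partialDeriv_eta hx 0)
    (h.ambient_partialDeriv_eta hx 1) (h.ambient_eta_eta x hx) (hz 0) (hz 1) hzn hzη

/-- The Gauss formula: second derivatives of the immersion in the frame `∂ᵤY, ∂ᵥY, n, η`. -/
theorem gauss_formula (i j : Fin 2) :
    partialDeriv i (partialDeriv j Y) x
      = christoffelOf a 0 i j x • partialDeriv 0 Y x
        + christoffelOf a 1 i j x • partialDeriv 1 Y x + b x i j • n x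
        - (ε * (a x i j - partialDeriv i Y x 3 * partialDeriv j Y x 3)) • eta (Y x) := by
  rw [← sub_eq_zero]
  apply h.eq_zero_of_orthogonal hx
  · intro l
    simp only [map_add, map_sub, map_smul, LinearMap.add_apply, LinearMap.sub_apply,
      LinearMap.smul_apply, smul_eq_mul, h.ambient_partialDeriv₂_tangent hx,
      ← h.first x hx, h.normal x hx, ambient_comm ε (eta (Y x)),
      h.ambient_partialDeriv_eta hx, h.first_symm hx l]
    ring
  · simp only [map_add, map_sub, map_smul, LinearMap.add_apply, LinearMap.sub_apply,
      LinearMap.smul_apply, smul_eq_mul, h.ambient_partialDeriv₂_normal hx,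
      ambient_comm ε (eta (Y x)), ambient_comm ε (partialDeriv _ Y x) (n x),
      h.normal x hx, h.unit x hx, h.tangent x hx]
    ring
  · simp only [map_add, map_sub, map_smul, LinearMap.add_apply, LinearMap.sub_apply,
      LinearMap.smul_apply, smul_eq_mul, h.ambient_partialDeriv₂_eta hx,
      h.ambient_partialDeriv_eta hx, h.tangent x hx, h.ambient_eta_eta x hx]
    linear_combination (a x i j - partialDeriv i Y x 3 * partialDeriv j Y x 3) * h.sq

/-- The Hessian of the height function of the immersion with respect to its first fundamental
form is the angle function `n₃` times the second fundamental form. -/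
theorem partialDeriv₂_height (i j : Fin 2) :
    partialDeriv i (partialDeriv j Y) x 3
      = christoffelOf a 0 i j x * partialDeriv 0 Y x 3
        + christoffelOf a 1 i j x * partialDeriv 1 Y x 3 + b x i j * n x 3 := by
  have h1 := congrArg (fun v : E4 => v 3) (h.gauss_formula hx i j)
  simpa [eta] using h1

/-- The relation `1 = |∇h|² + n₃²` between the gradient of the height function and the angle
function, multiplied by the determinant of the first fundamental form. -/
theorem det_eq_gradient_add_angle :
    (a x).det = a x 1 1 * partialDeriv 0 Y x 3 ^ 2
      - 2 * a x 0 1 * partialDeriv 0 Y x 3 * partialDeriv 1 Y x 3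
      + a x 0 0 * partialDeriv 1 Y x 3 ^ 2 + (a x).det * n x 3 ^ 2 := by
  set w : E4 := EuclideanSpace.single 3 1 with hw
  have hwy : ∀ y, ambient ε w y = y 3 := by intro y; simp [ambient_apply, hw]
  have hyw : ∀ y, ambient ε y w = y 3 := fun y => by rw [ambient_comm, hwy]
  have h10 := h.first_symm hx 1 0
  have hz : (a x).det • w - ((a x).det * n x 3) • n x
      - (a x 1 1 * partialDeriv 0 Y x 3 - a x 0 1 * partialDeriv 1 Y x 3) • partialDeriv 0 Y x
      - (a x 0 0 * partialDeriv 1 Y x 3 - a x 0 1 * partialDeriv 0 Y x 3) • partialDeriv 1 Y x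
      = 0 := by
    apply h.eq_zero_of_orthogonal hx
    · intro l
      simp only [map_sub, map_smul, LinearMap.sub_apply,
        LinearMap.smul_apply, smul_eq_mul, hwy, h.normal x hx, ← h.first x hx]
      fin_cases l
      · simp only [Fin.zero_eta, Matrix.det_fin_two, h10]; ring
      · simp only [Fin.mk_one, Matrix.det_fin_two, h10]; ring
    · simp only [map_sub, map_smul, LinearMap.sub_apply,
        LinearMap.smul_apply, smul_eq_mul, hwy, h.unit x hx,
        ambient_comm ε (partialDeriv _ Y x) (n x), h.normal x hx]
      ring
    · simp only [map_sub, map_smul, LinearMap.sub_apply,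
        LinearMap.smul_apply, smul_eq_mul, hwy, h.tangent x hx,
        h.ambient_partialDeriv_eta hx]
      simp [eta]
  have h1 := congrArg (fun z => ambient ε z w) hz
  simp only [map_sub, map_smul, LinearMap.sub_apply, LinearMap.smul_apply, smul_eq_mul, hyw,
    map_zero, LinearMap.zero_apply] at h1
  have hw3 : w 3 = 1 := by simp [hw]
  rw [hw3] at h1
  linear_combination h1

/-- The Codazzi equation of a surface in `M²(ε) × ℝ`. -/
theorem codazzi (k : Fin 2) :
    pd 1 (fun y => b y 0 k) x - pd 0 (fun y => b y 1 k) x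
      = christoffelOf a 0 k 1 x * b x 0 0 + christoffelOf a 1 k 1 x * b x 0 1
        - christoffelOf a 0 0 k x * b x 0 1 - christoffelOf a 1 0 k x * b x 1 1
        - ε * n x 3 * (a x 0 k * partialDeriv 1 Y x 3 - a x 1 k * partialDeriv 0 Y x 3) := by
  have hpd : ∀ i j, pd i (fun y => b y j k) x
      = -ambient ε (partialDeriv i (partialDeriv j n) x) (partialDeriv k Y x)
        - ambient ε (partialDeriv i (partialDeriv k Y) x) (partialDeriv j n x) := by
    intro i j
    have hn := contDiffOn_partialDeriv h.isOpen h.smooth_normal j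
    rw [pd_eq_partialDeriv, partialDeriv_congr h.isOpen (fun y hy => h.second y hy j k) i hx,
      partialDeriv_neg, partialDeriv_ambient ε (h.differentiableAt hx hn)
        (h.differentiableAt hx (h.smooth_partialDeriv k)),
      ambient_comm ε (partialDeriv i (partialDeriv k Y) x)]
    ring
  have hYn : ∀ i j, ambient ε (partialDeriv i Y x) (partialDeriv j n x) = -b x j i := by
    intro i j
    rw [h.second x hx, ambient_comm]; ring
  rw [hpd, hpd, partialDeriv_comm h.isOpen h.smooth_normal 1 0 hx,
    partialDeriv_comm h.isOpen h.smooth 1 k hx,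
    h.gauss_formula hx 0 k, h.gauss_formula hx k 1, h.first_symm hx k 1]
  simp only [map_add, map_sub, map_smul, LinearMap.add_apply, LinearMap.sub_apply,
    LinearMap.smul_apply, smul_eq_mul, hYn, h.ambient_partialDeriv_normal_self hx,
    h.ambient_eta_partialDeriv_normal hx, h.second_symm hx 1 0]
  ring

/-- Tangential component of the third derivatives of the immersion. -/
theorem ambient_partialDeriv₃_tangent (k i j l : Fin 2) :
    ambient ε (partialDeriv k (partialDeriv i (partialDeriv j Y)) x) (partialDeriv l Y x)
      = (∑ m, (a x l m * pd k (christoffelOf a m i j) x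
          + christoffelOf a m i j x * ∑ p, a x l p * christoffelOf a p k m x))
        - b x i j * b x k l
        - ε * (a x i j - partialDeriv i Y x 3 * partialDeriv j Y x 3)
          * (a x k l - partialDeriv k Y x 3 * partialDeriv l Y x 3) := by
  have hΓ : ∀ m, DifferentiableAt ℝ (christoffelOf a m i j) x := fun m =>
    h.differentiableAt hx (contDiffOn_christoffelOf h.isOpen h.smooth_first
      (fun y hy => h.det_ne hy) m i j)
  have ha : ∀ m, DifferentiableAt ℝ (fun y => a y l m) x := fun m =>
    h.differentiableAt hx (h.smooth_first l m)
  -- Differentiate the tangential part `⟨∂ᵢ∂ⱼY, ∂ₗY⟩ = ∑ aₗₘ Γᵢⱼᵐ` in both ways.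
  have h1 := partialDeriv_ambient ε
    (h.differentiableAt hx (contDiffOn_partialDeriv h.isOpen (h.smooth_partialDeriv j) i))
    (h.differentiableAt hx (h.smooth_partialDeriv l)) k
  rw [partialDeriv_congr h.isOpen
    (fun y hy => h.ambient_partialDeriv₂_tangent hy i j l) k hx,
    partialDeriv_mul_add_mul (ha 0) (hΓ 0) (ha 1) (hΓ 1)] at h1
  simp only [← pd_eq_partialDeriv, h.pd_first hx] at h1
  -- The product of two second derivatives is expanded by the Gauss formula.
  have h2 : ambient ε (partialDeriv i (partialDeriv j Y) x) (partialDeriv k (partialDeriv l Y) x)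
      = christoffelOf a 0 i j x
          * ambient ε (partialDeriv 0 Y x) (partialDeriv k (partialDeriv l Y) x)
        + christoffelOf a 1 i j x
          * ambient ε (partialDeriv 1 Y x) (partialDeriv k (partialDeriv l Y) x)
        + b x i j * b x k l
        + ε * (a x i j - partialDeriv i Y x 3 * partialDeriv j Y x 3)
          * (a x k l - partialDeriv k Y x 3 * partialDeriv l Y x 3) := by
    rw [h.gauss_formula hx i j]
    simp only [map_add, map_sub, map_smul, LinearMap.add_apply, LinearMap.sub_apply,
      LinearMap.smul_apply, smul_eq_mul]
    rw [ambient_comm ε (n x), h.ambient_partialDeriv₂_normal hx,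
      ambient_comm ε (eta (Y x)), h.ambient_partialDeriv₂_eta hx]
    ring
  rw [h2] at h1
  simp only [ambient_comm ε (partialDeriv l Y x), ambient_comm ε (partialDeriv 0 Y x),
    ambient_comm ε (partialDeriv 1 Y x)] at h1
  rw [h.ambient_partialDeriv₂_tangent hx k 0 l, h.ambient_partialDeriv₂_tangent hx k 1 l] at h1
  simp only [Fin.sum_univ_two]
  linear_combination -h1

/-- The Gauss equation: the intrinsic curvature of the first fundamental form, as computed from
its Christoffel symbols, is the extrinsic curvature plus the sectional curvature `ε n₃²` of
`M²(ε) × ℝ` on the tangent plane. -/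
theorem gauss_equation :
    ∑ l, a x l 0 * (pd 0 (christoffelOf a l 1 1) x - pd 1 (christoffelOf a l 0 1) x
      + ∑ m, (christoffelOf a m 1 1 x * christoffelOf a l 0 m x
        - christoffelOf a m 0 1 x * christoffelOf a l 1 m x))
      = (b x).det + ε * n x 3 ^ 2 * (a x).det := by
  have h1 := h.ambient_partialDeriv₃_tangent hx 0 1 1 0
  have h2 := h.ambient_partialDeriv₃_tangent hx 1 0 1 0
  rw [partialDeriv_comm h.isOpen (h.smooth_partialDeriv 1) 1 0 hx, h1] at h2
  have h3 := h.det_eq_gradient_add_angle hx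
  simp only [Fin.sum_univ_two, Matrix.det_fin_two] at h2 h3 ⊢
  rw [h.first_symm hx 1 0, h.second_symm hx 1 0] at *
  linear_combination h2 + ε * h3

end IsLocalImmersion


theorem christoffel_eq_christoffelOf {S : Type*} [TopologicalSpace S] [ChartedSpace E2 S]
    (A : FormField S) (φ : OpenPartialHomeomorph S E2) (k i j : Fin 2) (x : E2) :
    christoffel A φ k i j x = christoffelOf (coeff A φ) k i j x := rfl

/-! ### The modified metric in local parameters -/

/-- The constant `1 / (εK - 1)` in the modified metric equals `ε / (K - ε)`. -/
theorem one_div_mul_sub {ε K : ℝ} (hε : ε = 1 ∨ ε = -1) (hK : K ≠ ε) :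
    1 / (ε * K - 1) * (K - ε) = ε := by
  have hsq : ε * ε = 1 := by rcases hε with rfl | rfl <;> norm_num
  have h1 : ε * (ε * K - 1) = K - ε := by linear_combination K * hsq
  have h2 : ε * K - 1 ≠ 0 := right_ne_zero_of_mul (h1.trans_ne (sub_ne_zero.2 hK))
  rw [← h1, one_div, mul_left_comm, inv_mul_cancel₀ h2, mul_one]

namespace IsLocalImmersion

variable {ε K c : ℝ} {U : Set E2} {Y n : E2 → E4} {a b A : E2 → Matrix (Fin 2) (Fin 2) ℝ}
  (h : IsLocalImmersion ε U Y n a b)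
  (hA : ∀ y ∈ U, ∀ i j, A y i j
    = a y i j + c * (partialDeriv i Y y 3 * partialDeriv j Y y 3))
  (hc : c * (K - ε) = ε) {x : E2} (hx : x ∈ U)

include h hA hx

theorem pd_modified (k i j : Fin 2) :
    pd k (fun y => A y i j) x = pd k (fun y => a y i j) x
      + c * (partialDeriv k (partialDeriv i Y) x 3 * partialDeriv j Y x 3
        + partialDeriv i Y x 3 * partialDeriv k (partialDeriv j Y) x 3) := by
  have hd : ∀ l, DifferentiableAt ℝ (partialDeriv l Y) x := fun l =>
    h.differentiableAt hx (h.smooth_partialDeriv l)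
  have hh : ∀ l, DifferentiableAt ℝ (fun y => partialDeriv l Y y 3) x := fun l =>
    (EuclideanSpace.proj (𝕜 := ℝ) (3 : Fin 4)).differentiableAt.comp x (hd l)
  rw [pd_eq_partialDeriv, partialDeriv_congr h.isOpen (fun y hy => hA y hy i j) k hx,
    partialDeriv_add_const_mul (h.differentiableAt hx (h.smooth_first i j)) (hh i) (hh j),
    partialDeriv_coord (hd i), partialDeriv_coord (hd j), pd_eq_partialDeriv]

theorem firstKind_modified (i j l : Fin 2) :
    firstKind A i j l x = firstKind a i j l x
      + c * partialDeriv i (partialDeriv j Y) x 3 * partialDeriv l Y x 3 := by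
  simp only [firstKind, h.pd_modified hA hx]
  rw [partialDeriv_comm h.isOpen h.smooth j i hx, partialDeriv_comm h.isOpen h.smooth l i hx,
    partialDeriv_comm h.isOpen h.smooth l j hx]
  ring

/-- The Levi-Civita connections of the modified metric and of the first fundamental form differ
by `c n₃ II ⊗ ∇h`, the gradient of the height `h` being taken with respect to the modified
metric. The components of `∇h` are written by Cramer's rule. -/
theorem christoffelOf_modified (hdet : (A x).det ≠ 0) (k i j : Fin 2) :
    christoffelOf A k i j x = christoffelOf a k i j x
      + c * n x 3 * b x i j *
        (![a x 1 1 * partialDeriv 0 Y x 3 - a x 0 1 * partialDeriv 1 Y x 3,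
           a x 0 0 * partialDeriv 1 Y x 3 - a x 0 1 * partialDeriv 0 Y x 3] k / (A x).det) := by
  refine christoffelOf_unique (γ := fun k => christoffelOf a k i j x
      + c * n x 3 * b x i j *
        (![a x 1 1 * partialDeriv 0 Y x 3 - a x 0 1 * partialDeriv 1 Y x 3,
           a x 0 0 * partialDeriv 1 Y x 3 - a x 0 1 * partialDeriv 0 Y x 3] k / (A x).det))
    hdet (fun l => ?_) k
  have hΓ := mulVec_christoffelOf (h.det_ne hx) i j l
  -- `A` applied to the gradient of the height gives back the differential of the height.
  have hgrad :
      A x l 0 * ((a x 1 1 * partialDeriv 0 Y x 3 - a x 0 1 * partialDeriv 1 Y x 3) / (A x).det)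
      + A x l 1 * ((a x 0 0 * partialDeriv 1 Y x 3 - a x 0 1 * partialDeriv 0 Y x 3) / (A x).det)
      = partialDeriv l Y x 3 := by
    rw [← mul_div_assoc, ← mul_div_assoc, ← add_div, div_eq_iff hdet]
    have h10 := h.first_symm hx 1 0
    fin_cases l
    · simp only [Fin.zero_eta, Matrix.det_fin_two, hA x hx, h10]; ring
    · simp only [Fin.mk_one, Matrix.det_fin_two, hA x hx, h10]; ring
  rw [h.firstKind_modified hA hx, h.partialDeriv₂_height hx, ← hΓ]
  simp only [Matrix.cons_val_zero, Matrix.cons_val_one]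
  linear_combination c * n x 3 * b x i j * hgrad + christoffelOf a 0 i j x * hA x hx l 0
    + christoffelOf a 1 i j x * hA x hx l 1

include hc

theorem det_modified : (K - ε) * (A x).det = (K - ε * n x 3 ^ 2) * (a x).det := by
  have h1 := h.det_eq_gradient_add_angle hx
  simp only [Matrix.det_fin_two, hA x hx] at h1 ⊢
  rw [h.first_symm hx 1 0] at *
  linear_combination (a x 1 1 * partialDeriv 0 Y x 3 ^ 2
      - 2 * a x 0 1 * partialDeriv 0 Y x 3 * partialDeriv 1 Y x 3
      + a x 0 0 * partialDeriv 1 Y x 3 ^ 2) * hc - ε * h1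

/-- The extrinsic curvature of the pair formed by the modified metric and the second fundamental
form is `K - ε`, in the form of a product. The hypothesis `hG` is the Gauss equation for
Gaussian curvature `K`. -/
theorem det_second_eq (hG : (b x).det = (K - ε * n x 3 ^ 2) * (a x).det) :
    (b x).det = (K - ε) * (A x).det := by
  rw [hG, h.det_modified hA hc hx]

/-- The Codazzi equation with respect to the modified metric: the curvature term in the Codazzi
equation of the first fundamental form is cancelled by the difference of the two connections. -/
theorem codazzi_modified (hdet : (A x).det ≠ 0)
    (hG : (b x).det = (K - ε * n x 3 ^ 2) * (a x).det) (k : Fin 2) :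
    pd 1 (fun y => b y 0 k) x - pd 0 (fun y => b y 1 k) x
      = christoffelOf A 0 k 1 x * b x 0 0 + christoffelOf A 1 k 1 x * b x 0 1
        - christoffelOf A 0 0 k x * b x 0 1 - christoffelOf A 1 0 k x * b x 1 1 := by
  have hcb : c * (b x).det / (A x).det = ε := by
    rw [h.det_second_eq hA hc hx hG, ← mul_assoc, hc, mul_div_assoc, div_self hdet, mul_one]
  rw [Matrix.det_fin_two (b x), h.second_symm hx 1 0] at hcb
  rw [h.codazzi hx]
  simp only [h.christoffelOf_modified hA hx hdet, Matrix.cons_val_zero, Matrix.cons_val_one]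
  have h10 := h.first_symm hx 1 0
  fin_cases k
  · simp only [Fin.zero_eta, h10]
    linear_combination
      n x 3 * (a x 0 0 * partialDeriv 1 Y x 3 - a x 0 1 * partialDeriv 0 Y x 3) * hcb
  · simp only [Fin.mk_one]
    linear_combination
      n x 3 * (a x 0 1 * partialDeriv 1 Y x 3 - a x 1 1 * partialDeriv 0 Y x 3) * hcb

end IsLocalImmersion

/-! ### Passage to charts -/

section Surface

variable {S : Type*} [TopologicalSpace S] [ChartedSpace E2 S]
  {φ : OpenPartialHomeomorph S E2} {x : E2}

theorem mdifferentiable_of_mem_maximalAtlas (hφ : φ ∈ IsManifold.maximalAtlas (𝓡 2) ∞ S) :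
    φ.MDifferentiable (𝓡 2) (𝓡 2) :=
  ⟨(contMDiffOn_of_mem_maximalAtlas hφ).mdifferentiableOn (by simp),
    (contMDiffOn_symm_of_mem_maximalAtlas hφ).mdifferentiableOn (by simp)⟩

theorem bijective_mfderiv_symm (hφ : φ ∈ IsManifold.maximalAtlas (𝓡 2) ∞ S)
    (hx : x ∈ φ.target) : Function.Bijective (mfderiv (𝓡 2) (𝓡 2) φ.symm x) :=
  (mdifferentiable_of_mem_maximalAtlas hφ).symm.mfderiv_bijective hx

theorem eq_sum_basis (v : E2) : v = v 0 • e 0 + v 1 • e 1 := by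
  ext k
  fin_cases k <;> simp [e]

theorem coordVec_indep (hφ : φ ∈ IsManifold.maximalAtlas (𝓡 2) ∞ S) (hx : x ∈ φ.target)
    {s t : ℝ} (hst : s • coordVec φ x 0 + t • coordVec φ x 1 = 0) : s = 0 ∧ t = 0 := by
  have h1 : mfderiv (𝓡 2) (𝓡 2) φ.symm x (s • e 0 + t • e 1 : E2) = 0 := by
    rw [← hst]
    exact (map_add _ _ _).trans (congrArg₂ _ (map_smul _ _ _) (map_smul _ _ _))
  have h2 : (s • e 0 + t • e 1 : E2) = 0 :=
    (bijective_mfderiv_symm hφ hx).1 (h1.trans (map_zero _).symm)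
  have h3 := congrArg (fun v : E2 => v 0) h2
  have h4 := congrArg (fun v : E2 => v 1) h2
  simp [e] at h3 h4
  exact ⟨h3, h4⟩

theorem exists_eq_coordVec (hφ : φ ∈ IsManifold.maximalAtlas (𝓡 2) ∞ S) (hx : x ∈ φ.target)
    (v : TangentSpace (𝓡 2) (φ.symm x)) :
    ∃ s t : ℝ, v = s • coordVec φ x 0 + t • coordVec φ x 1 := by
  obtain ⟨w, rfl⟩ := (bijective_mfderiv_symm hφ hx).2 v
  refine ⟨(id w : E2) 0, (id w : E2) 1, ?_⟩
  exact (congrArg _ (eq_sum_basis w)).trans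
    ((map_add _ _ _).trans (congrArg₂ _ (map_smul _ _ _) (map_smul _ _ _)))

theorem contDiffOn_comp_symm {f : S → E4} (hf : ContMDiff (𝓡 2) 𝓘(ℝ, E4) ∞ f)
    (hφ : φ ∈ IsManifold.maximalAtlas (𝓡 2) ∞ S) :
    ContDiffOn ℝ ∞ (fun y => f (φ.symm y)) φ.target :=
  contMDiffOn_iff_contDiffOn.1
    (hf.comp_contMDiffOn (contMDiffOn_symm_of_mem_maximalAtlas hφ))

theorem diff_coordVec {f : S → E4} (hf : ContMDiff (𝓡 2) 𝓘(ℝ, E4) ∞ f)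
    (hφ : φ ∈ IsManifold.maximalAtlas (𝓡 2) ∞ S) (hx : x ∈ φ.target) (i : Fin 2) :
    diff f (φ.symm x) (coordVec φ x i) = partialDeriv i (fun y => f (φ.symm y)) x := by
  have h1 := mfderiv_comp (I := 𝓡 2) (I' := 𝓡 2) (I'' := 𝓘(ℝ, E4)) x
    (hf.mdifferentiableAt (by simp) : MDifferentiableAt (𝓡 2) 𝓘(ℝ, E4) f (φ.symm x))
    ((mdifferentiable_of_mem_maximalAtlas hφ).symm.mdifferentiableAt hx)
  rw [mfderiv_eq_fderiv] at h1
  exact (congrArg (fun L : E2 →L[ℝ] E4 => L (e i)) h1).symm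

theorem dheight_apply {ψ : S → E4} (hψ : ContMDiff (𝓡 2) 𝓘(ℝ, E4) ∞ ψ) (p : S)
    (v : TangentSpace (𝓡 2) p) : dheight ψ p v = diff ψ p v 3 := by
  have h1 := mfderiv_comp (I := 𝓡 2) (I' := 𝓘(ℝ, E4)) (I'' := 𝓘(ℝ, ℝ)) p
    (EuclideanSpace.proj (𝕜 := ℝ) (3 : Fin 4)).differentiableAt.mdifferentiableAt
    (hψ.mdifferentiableAt (by simp) : MDifferentiableAt (𝓡 2) 𝓘(ℝ, E4) ψ p)
  rw [mfderiv_eq_fderiv, ContinuousLinearMap.fderiv] at h1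
  exact congrArg (fun L : E2 →L[ℝ] ℝ => L v) h1

/-- The matrix of a bilinear form on a tangent plane in the basis of the model space `ℝ²`, with
which every tangent plane is identified. -/
def modelCoeff (B : FormField S) (p : S) : Matrix (Fin 2) (Fin 2) ℝ :=
  Matrix.of fun i j => B p (e i : E2) (e j : E2)

/-- The components of the coordinate vectors of a chart in the basis of the model space. -/
def frameMatrix (φ : OpenPartialHomeomorph S E2) (x : E2) : Matrix (Fin 2) (Fin 2) ℝ :=
  Matrix.of fun i j => (id (coordVec φ x i) : E2) j

theorem bilinForm_apply_eq (B : LinearMap.BilinForm ℝ E2) (v w : E2) :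
    B v w = v 0 * w 0 * B (e 0) (e 0) + v 0 * w 1 * B (e 0) (e 1)
      + v 1 * w 0 * B (e 1) (e 0) + v 1 * w 1 * B (e 1) (e 1) := by
  conv_lhs => rw [eq_sum_basis v, eq_sum_basis w]
  simp only [map_add, map_smul, LinearMap.add_apply, LinearMap.smul_apply, smul_eq_mul]
  ring

/-- The determinants of all form fields at a point change by a common factor from one chart to
another. -/
theorem det_coeff_eq (B : FormField S) (φ : OpenPartialHomeomorph S E2) (x : E2) :
    (coeff B φ x).det = (frameMatrix φ x).det ^ 2 * (modelCoeff B (φ.symm x)).det := by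
  have h1 : ∀ i j, coeff B φ x i j
      = frameMatrix φ x i 0 * frameMatrix φ x j 0 * modelCoeff B (φ.symm x) 0 0
        + frameMatrix φ x i 0 * frameMatrix φ x j 1 * modelCoeff B (φ.symm x) 0 1
        + frameMatrix φ x i 1 * frameMatrix φ x j 0 * modelCoeff B (φ.symm x) 1 0
        + frameMatrix φ x i 1 * frameMatrix φ x j 1 * modelCoeff B (φ.symm x) 1 1 :=
    fun i j => bilinForm_apply_eq (B (φ.symm x)) (coordVec φ x i) (coordVec φ x j)
  simp only [Matrix.det_fin_two, h1]
  ring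

variable {ε K : ℝ} {ψ N : S → E4}

theorem isLocalImmersion (hε : ε = 1 ∨ ε = -1) (hψ : IsImmersionInto ε ψ)
    (hN : IsUnitNormal ε ψ N) (hφ : φ ∈ IsManifold.maximalAtlas (𝓡 2) ∞ S) :
    IsLocalImmersion ε φ.target (fun y => ψ (φ.symm y)) (fun y => N (φ.symm y))
      (coeff (firstForm ε ψ) φ) (coeff (secondForm ε ψ N) φ) where
  eps := hε
  isOpen := φ.open_target
  smooth := contDiffOn_comp_symm hψ.smooth hφ
  smooth_normal := contDiffOn_comp_symm hN.smooth hφ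
  mem x _ := hψ.mem _
  indep x hx s t hst := by
    rw [← diff_coordVec hψ.smooth hφ hx, ← diff_coordVec hψ.smooth hφ hx, ← map_smul,
      ← map_smul, ← map_add] at hst
    exact coordVec_indep hφ hx (hψ.injective _ (hst.trans (map_zero _).symm))
  tangent x _ := hN.tangent _
  normal x hx i := by
    rw [← diff_coordVec hψ.smooth hφ hx]
    exact hN.normal _ _
  unit x _ := hN.unit _
  first x hx i j := by
    rw [← diff_coordVec hψ.smooth hφ hx, ← diff_coordVec hψ.smooth hφ hx]
    rfl
  second x hx i j := by
    rw [← diff_coordVec hψ.smooth hφ hx, ← diff_coordVec hN.smooth hφ hx]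
    change ambient ε (-(diff N (φ.symm x) (coordVec φ x i))) _ = _
    rw [map_neg, LinearMap.neg_apply]

theorem coeff_modifiedForm (hψ : IsImmersionInto ε ψ)
    (hK : ∀ p, gaussianCurvature (firstForm ε ψ) p = K)
    (hφ : φ ∈ IsManifold.maximalAtlas (𝓡 2) ∞ S) (hx : x ∈ φ.target) (i j : Fin 2) :
    coeff (modifiedForm ε ψ) φ x i j = coeff (firstForm ε ψ) φ x i j
      + 1 / (ε * K - 1) * (partialDeriv i (fun y => ψ (φ.symm y)) x 3
        * partialDeriv j (fun y => ψ (φ.symm y)) x 3) := by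
  rw [← diff_coordVec hψ.smooth hφ hx, ← diff_coordVec hψ.smooth hφ hx,
    ← dheight_apply hψ.smooth, ← dheight_apply hψ.smooth, ← hK (φ.symm x)]
  rfl

variable [IsManifold (𝓡 2) ∞ S]

/-- The Gauss equation at the point of a chart, with the Gaussian curvature computed in the
preferred chart at that point. -/
theorem det_secondForm (hε : ε = 1 ∨ ε = -1) (hψ : IsImmersionInto ε ψ)
    (hN : IsUnitNormal ε ψ N) (hK : ∀ p, gaussianCurvature (firstForm ε ψ) p = K)
    (φ : OpenPartialHomeomorph S E2) (x : E2) :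
    (coeff (secondForm ε ψ N) φ x).det
      = (K - ε * N (φ.symm x) 3 ^ 2) * (coeff (firstForm ε ψ) φ x).det := by
  have key : ∀ p : S, (modelCoeff (secondForm ε ψ N) p).det
      = (K - ε * N p 3 ^ 2) * (modelCoeff (firstForm ε ψ) p).det := by
    intro p
    have h := isLocalImmersion hε hψ hN (IsManifold.chart_mem_maximalAtlas (I := 𝓡 2) (n := ∞) p)
    have hp : chartAt E2 p p ∈ (chartAt E2 p).target := mem_chart_target E2 p
    have hdet := h.det_ne hp
    have hG := h.gauss_equation hp
    have hKp := hK p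
    rw [gaussianCurvature, gaussianCurvatureIn, div_eq_iff hdet] at hKp
    have hG' := hKp.symm.trans hG
    simp only [det_coeff_eq, (chartAt E2 p).left_inv (mem_chart_source E2 p)] at hdet hG'
    apply mul_left_cancel₀ (left_ne_zero_of_mul hdet)
    linear_combination -hG'
  rw [det_coeff_eq, det_coeff_eq, key]
  ring

theorem det_coeff_pos {A : FormField S} (hA : IsRiemannianMetric A)
    (hφ : φ ∈ IsManifold.maximalAtlas (𝓡 2) ∞ S) (hx : x ∈ φ.target) :
    0 < (coeff A φ x).det := by
  obtain ⟨g, hg⟩ := hA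
  rw [Matrix.det_fin_two]
  refine gram_det_pos (A (φ.symm x)) ?_ fun s t hst => ?_
  · rw [← hg, ← hg, g.symm]
  · rw [← hg]
    refine g.pos _ _ fun h0 => ?_
    obtain ⟨hs, ht⟩ := coordVec_indep hφ hx h0
    simp [hs, ht] at hst

theorem isSmoothQuadraticForm_secondForm (hε : ε = 1 ∨ ε = -1) (hψ : IsImmersionInto ε ψ)
    (hN : IsUnitNormal ε ψ N) : IsSmoothQuadraticForm (secondForm ε ψ N) where
  smooth φ hφ i j := (isLocalImmersion hε hψ hN hφ).smooth_second i j
  symm p v w := by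
    obtain ⟨φ, hφ, x, hx, rfl⟩ : ∃ φ ∈ IsManifold.maximalAtlas (𝓡 2) ∞ S,
        ∃ x ∈ φ.target, φ.symm x = p :=
      ⟨chartAt E2 p, IsManifold.chart_mem_maximalAtlas p, chartAt E2 p p,
        mem_chart_target E2 p, (chartAt E2 p).left_inv (mem_chart_source E2 p)⟩
    have h01 : secondForm ε ψ N (φ.symm x) (coordVec φ x 0) (coordVec φ x 1)
        = secondForm ε ψ N (φ.symm x) (coordVec φ x 1) (coordVec φ x 0) :=
      (isLocalImmersion hε hψ hN hφ).second_symm hx 0 1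
    obtain ⟨s, t, rfl⟩ := exists_eq_coordVec hφ hx v
    obtain ⟨s', t', rfl⟩ := exists_eq_coordVec hφ hx w
    simp only [map_add, map_smul, LinearMap.add_apply, LinearMap.smul_apply, smul_eq_mul, h01]
    ring

end Surface

end ProductSurface

end

theorem theorem1 {S : Type*} [TopologicalSpace S] [ChartedSpace ProductSurface.E2 S]
    [IsManifold (𝓡 2) ∞ S] (ε : ℝ) (hε : ε = 1 ∨ ε = -1)
    (ψ N : S → ProductSurface.E4)
    (hψ : ProductSurface.IsImmersionInto ε ψ) (hN : ProductSurface.IsUnitNormal ε ψ N)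
    (K : ℝ) (hK : ∀ p, ProductSurface.gaussianCurvature (ProductSurface.firstForm ε ψ) p = K)
    (hKε : K ≠ ε)
    (hA : ProductSurface.IsRiemannianMetric (ProductSurface.modifiedForm ε ψ)) :
    ProductSurface.IsCodazziPair (ProductSurface.modifiedForm ε ψ)
        (ProductSurface.secondForm ε ψ N) ∧
      ∀ φ ∈ IsManifold.maximalAtlas (𝓡 2) ∞ S, ∀ x ∈ φ.target,
        ProductSurface.extrinsicCurvatureIn (ProductSurface.modifiedForm ε ψ)
          (ProductSurface.secondForm ε ψ N) φ x = K - ε := by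
  have hloc := fun φ (hφ : φ ∈ IsManifold.maximalAtlas (𝓡 2) ∞ S) =>
    ProductSurface.isLocalImmersion hε hψ hN hφ
  have hcod := fun φ (hφ : φ ∈ IsManifold.maximalAtlas (𝓡 2) ∞ S) x (hx : x ∈ φ.target) =>
    (hloc φ hφ).codazzi_modified
      (fun y hy => ProductSurface.coeff_modifiedForm hψ hK hφ hy)
      (ProductSurface.one_div_mul_sub hε hKε) hx
      (ProductSurface.det_coeff_pos hA hφ hx).ne'
      (ProductSurface.det_secondForm hε hψ hN hK φ x)
  refine ⟨⟨hA, ProductSurface.isSmoothQuadraticForm_secondForm hε hψ hN,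
    fun φ hφ x hx => ?_, fun φ hφ x hx => ?_⟩, fun φ hφ x hx => ?_⟩
  · have h1 := hcod φ hφ x hx 0
    rw [ProductSurface.pd_eq_partialDeriv 0, ProductSurface.partialDeriv_congr φ.open_target
      (fun y hy => (hloc φ hφ).second_symm hy 1 0) 0 hx] at h1
    refine h1.trans ?_
    simp only [ProductSurface.christoffel_eq_christoffelOf]
    ring
  · refine (hcod φ hφ x hx 1).trans ?_
    simp only [ProductSurface.christoffel_eq_christoffelOf]
    ring
  · rw [ProductSurface.extrinsicCurvatureIn,
      div_eq_iff (ProductSurface.det_coeff_pos hA hφ hx).ne']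
    exact (hloc φ hφ).det_second_eq
      (fun y hy => ProductSurface.coeff_modifiedForm hψ hK hφ hy)
      (ProductSurface.one_div_mul_sub hε hKε) hx
      (ProductSurface.det_secondForm hε hψ hN hK φ x)
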